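/- Let $d\ge 2$, let $\Omega\subset\mathbb R^d$ be a bounded open set with $C^1$ boundary and outer unit normal $\nu$, let $T>0$, $J\in\mathbb N$, $J\ge1$, $\Delta t=T/J$. Let $N\ge 1$, $0=\alpha_0<\alpha_1<\dots<\alpha_N$ be real numbers, $s=\alpha_N+2$, $s^*=s/(s-1)$, and $$W(\mathrm{div};\Omega)=\{\mathbf v\in (L^s(\Omega))^d:\ \nabla\cdot\mathbf v\in L^2(\Omega)\}$$ with the divergence in the sense of distributions. For $j=1,\dots,J$ let the following be given. * Coefficients $a_i^j\in L^\infty(\Omega)$, $i=0,\dots,N$, with $0\le a_i^j\le\overline a$ for all $i$ and $\underline a<a_0^j,a_N^j<\overline a$ a.e. in $\Omega$, where $0<\underline a<\overline a<\infty$ are constants; put $F^j(x,z)=\sum_{i=0}^N a_i^j(x)z^{\alpha_i}$ for $z\ge 0$. * A measurable porosity $\phi$, independent of $j$, with $0<\underline\phi\le\phi\le\overline\phi<\infty$ a.e. in $\Omega$. * Source terms $f^j\in L^2(\Omega)$, and an initial density $\rho_0\in L^2(\Omega)$. * Boundary data $\rho_b^j$ in the space of traces on $\partial\Omega$ of the functions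 $\psi\in L^2(\Omega)$ with $\nabla\psi\in(L^{s^*}(\Omega))^d$; two such functions have the same trace if their difference lies in the closure of $C_c^\infty(\Omega)$ in the norm $\|\psi\|_{L^2}+\|\nabla\psi\|_{L^{s^*}}$. For $\mathbf v\in W(\mathrm{div};\Omega)$ the pairing of $\rho_b^j$ with the normal trace of $\mathbf v$ is given by Green's formula, $$\langle\rho_b^j,\mathbf v\cdot\nu\rangle=\int_\Omega\psi\,\nabla\cdot\mathbf v\,dx+\int_\Omega\nabla\psi\cdot\mathbf v\,dx,$$ for any such $\psi$ with trace $\rho_b^j$; it does not depend on the choice of $\psi$. Then for every $j\in\{1,\dots,J\}$ and every $\rho^{j-1}\in L^2(\Omega)$ there is exactly one pair $(\mathbf m^j,\rho^j)\in W(\mathrm{div};\Omega)\times L^2(\Omega)$ such that $$\int_\Omega F^j(x,|\mathbf m^j|)\,\mathbf m^j\cdot\mathbf v\,dx-\int_\Omega\rho^j\,\nabla\cdot\mathbf v\,dx=-\langle\rho_b^j,\mathbf v\cdot\nu\rangle\qquad\text{for all }\mathbf v\in W(\mathrm{div};\Omega),$$ $$\int_\Omega\frac{\phi\rho^j}{\Delta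 t}\,q\,dx+\int_\Omega(\nabla\cdot\mathbf m^j)\,q\,dx=\int_\Omega f^jq\,dx+\int_\Omega\frac{\phi\rho^{j-1}}{\Delta t}\,q\,dx\qquad\text{for all }q\in L^2(\Omega).$$ Consequently, there is exactly one family $(\mathbf m^j,\rho^j)_{1\le j\le J}$ in $W(\mathrm{div};\Omega)\times L^2(\Omega)$ that, with $\rho^0=\rho_0$, satisfies these equations for all $j=1,\dots,J$. -/

import Mathlib

open MeasureTheory
open scoped ENNReal ContDiff

noncomputable section

namespace Forchheimer

/-- The exponents `0 = α₀ < α₁ < ⋯ < α_N`, `N ≥ 1`, of the generalized polynomial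
`F(x, z) = ∑ i, a_i(x) z ^ α_i`. -/
structure Exponents where
  N : ℕ
  one_le_N : 1 ≤ N
  α : Fin (N + 1) → ℝ
  α_zero : α 0 = 0
  strictMono : StrictMono α

namespace Exponents

variable (e : Exponents)

/-- `s = α_N + 2`. -/
def s : ℝ := e.α (Fin.last e.N) + 2

/-- The conjugate exponent `s* = s / (s - 1)`. -/
def sStar : ℝ := e.s / (e.s - 1)

/-- `s`, as an exponent of a Lebesgue space. -/
def p : ℝ≥0∞ := ENNReal.ofReal e.s

/-- `s*`, as an exponent of a Lebesgue space. -/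
def q : ℝ≥0∞ := ENNReal.ofReal e.sStar

theorem two_lt_s : 2 < e.s := by
  have h : e.α 0 < e.α (Fin.last e.N) := e.strictMono (by
    have := e.one_le_N
    simp [Fin.lt_def]; omega)
  rw [e.α_zero] at h
  unfold s; linarith

theorem holderConjugate_real : e.s.HolderConjugate e.sStar :=
  Real.HolderConjugate.conjExponent (by linarith [e.two_lt_s])

instance : ENNReal.HolderConjugate e.p e.q := e.holderConjugate_real.ennrealOfReal

instance : ENNReal.HolderConjugate e.q e.p := ENNReal.HolderConjugate.symm

instance : Fact (1 ≤ e.p) := ⟨ENNReal.HolderConjugate.one_le e.p e.q⟩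

instance : Fact (1 ≤ e.q) := ⟨ENNReal.HolderConjugate.one_le e.q e.p⟩

end Exponents

/-- `ℝᵈ` with its Euclidean norm. -/
abbrev Space (d : ℕ) : Type := EuclideanSpace ℝ (Fin d)

/-- The space `Lʳ(Ω)` of scalar functions. -/
abbrev LScalar {d : ℕ} (Ω : Set (Space d)) (r : ℝ≥0∞) : Type :=
  Lp ℝ r (volume.restrict Ω)

/-- The space `(Lʳ(Ω))ᵈ` of vector fields. -/
abbrev LVector {d : ℕ} (Ω : Set (Space d)) (r : ℝ≥0∞) : Type :=
  Lp (Space d) r (volume.restrict Ω)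

/-- `φ ∈ C_c^∞(Ω)`. -/
structure IsTest {d : ℕ} (Ω : Set (Space d)) (φ : Space d → ℝ) : Prop where
  smooth : ContDiff ℝ ∞ φ
  compact : HasCompactSupport φ
  supp : tsupport φ ⊆ Ω

/-- `w` is the weak divergence of `v` on `Ω`. -/
def HasWeakDiv {d : ℕ} (Ω : Set (Space d)) (v : Space d → Space d) (w : Space d → ℝ) : Prop :=
  ∀ φ, IsTest Ω φ → ∫ x in Ω, inner ℝ (v x) (gradient φ x) = -∫ x in Ω, w x * φ x

/-- `g` is the weak gradient of `ψ` on `Ω`. -/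
def HasWeakGrad {d : ℕ} (Ω : Set (Space d)) (ψ : Space d → ℝ) (g : Space d → Space d) : Prop :=
  ∀ φ, IsTest Ω φ → ∫ x in Ω, ψ x • gradient φ x = -∫ x in Ω, φ x • g x

section helpers

variable {d : ℕ} {Ω : Set (Space d)} {φ : Space d → ℝ}

theorem IsTest.memLp (h : IsTest Ω φ) (r : ℝ≥0∞) : MemLp φ r (volume.restrict Ω) :=
  (h.smooth.continuous.memLp_of_hasCompactSupport h.compact).restrict Ω

theorem IsTest.memLp_gradient (h : IsTest Ω φ) (r : ℝ≥0∞) :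
    MemLp (gradient φ) r (volume.restrict Ω) := by
  have hc : Continuous (gradient φ) :=
    (InnerProductSpace.toDual ℝ (Space d)).symm.continuous.comp
      (h.smooth.continuous_fderiv (by simp))
  have hs : HasCompactSupport (gradient φ) :=
    (h.compact.fderiv ℝ).comp_left
      (g := (InnerProductSpace.toDual ℝ (Space d)).symm) (map_zero _)
  exact (hc.memLp_of_hasCompactSupport hs).restrict Ω

theorem integrable_mul_of_Lp {r t : ℝ≥0∞} [ENNReal.HolderConjugate r t] {u w : Space d → ℝ}
    (hu : MemLp u r (volume.restrict Ω)) (hw : MemLp w t (volume.restrict Ω)) :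
    Integrable (fun x => u x * w x) (volume.restrict Ω) :=
  hu.integrable_mul hw

theorem integrable_inner_of_Lp {r t : ℝ≥0∞} [ENNReal.HolderConjugate r t]
    {u w : Space d → Space d}
    (hu : MemLp u r (volume.restrict Ω)) (hw : MemLp w t (volume.restrict Ω)) :
    Integrable (fun x => inner ℝ (u x) (w x)) (volume.restrict Ω) :=
  memLp_one_iff_integrable.1
    (MemLp.of_bilin (r := 1) (fun a b => inner ℝ a b) 1 hu hw
      (hu.1.inner hw.1) (.of_forall fun x => by
        rw [one_mul]; exact norm_inner_le_norm (u x) (w x)))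

theorem integrable_smul_of_Lp {r t : ℝ≥0∞} [ENNReal.HolderConjugate r t]
    {u : Space d → ℝ} {w : Space d → Space d}
    (hu : MemLp u r (volume.restrict Ω)) (hw : MemLp w t (volume.restrict Ω)) :
    Integrable (fun x => u x • w x) (volume.restrict Ω) :=
  memLp_one_iff_integrable.1 (hw.smul hu)

end helpers

/-- `W(div; Ω) = {v ∈ (Lˢ(Ω))ᵈ : div v ∈ L²(Ω)}`, realized as a subspace of
`(Lˢ(Ω))ᵈ × L²(Ω)`: its elements are the pairs `(v, div v)`, in which the first component
determines the second one (`Wdiv_ext`). -/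
def Wdiv {d : ℕ} (Ω : Set (Space d)) (e : Exponents) :
    Submodule ℝ (LVector Ω e.p × LScalar Ω 2) where
  carrier := {z | HasWeakDiv Ω z.1 z.2}
  zero_mem' := by
    intro φ _
    have h1 : ∫ x in Ω, inner ℝ ((0 : LVector Ω e.p) x) (gradient φ x) = 0 := by
      refine integral_eq_zero_of_ae ?_
      filter_upwards [Lp.coeFn_zero (Space d) e.p (volume.restrict Ω)] with x hx
      rw [hx]; simp
    have h2 : ∫ x in Ω, (0 : LScalar Ω 2) x * φ x = 0 := by
      refine integral_eq_zero_of_ae ?_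
      filter_upwards [Lp.coeFn_zero ℝ 2 (volume.restrict Ω)] with x hx
      rw [hx]; simp
    simp only [Prod.fst_zero, Prod.snd_zero]
    rw [h1, h2, neg_zero]
  add_mem' := by
    intro y z hy hz φ hφ
    have h1 : ∫ x in Ω, inner ℝ ((y.1 + z.1 : LVector Ω e.p) x) (gradient φ x)
        = (∫ x in Ω, inner ℝ (y.1 x) (gradient φ x))
          + ∫ x in Ω, inner ℝ (z.1 x) (gradient φ x) := by
      rw [← integral_add
        (integrable_inner_of_Lp (Lp.memLp y.1) (hφ.memLp_gradient e.q))
        (integrable_inner_of_Lp (Lp.memLp z.1) (hφ.memLp_gradient e.q))]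
      refine integral_congr_ae ?_
      filter_upwards [Lp.coeFn_add y.1 z.1] with x hx
      rw [hx, Pi.add_apply, inner_add_left]
    have h2 : ∫ x in Ω, (y.2 + z.2 : LScalar Ω 2) x * φ x
        = (∫ x in Ω, y.2 x * φ x) + ∫ x in Ω, z.2 x * φ x := by
      rw [← integral_add
        (integrable_mul_of_Lp (Lp.memLp y.2) (hφ.memLp 2))
        (integrable_mul_of_Lp (Lp.memLp z.2) (hφ.memLp 2))]
      refine integral_congr_ae ?_
      filter_upwards [Lp.coeFn_add y.2 z.2] with x hx
      rw [hx, Pi.add_apply, add_mul]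
    have hy' := hy φ hφ
    have hz' := hz φ hφ
    simp only [Prod.fst_add, Prod.snd_add]
    rw [h1, h2, hy', hz']; ring
  smul_mem' := by
    intro c z hz φ hφ
    have h1 : ∫ x in Ω, inner ℝ ((c • z.1 : LVector Ω e.p) x) (gradient φ x)
        = c * ∫ x in Ω, inner ℝ (z.1 x) (gradient φ x) := by
      rw [← integral_const_mul]
      refine integral_congr_ae ?_
      filter_upwards [Lp.coeFn_smul c z.1] with x hx
      rw [hx, Pi.smul_apply, real_inner_smul_left]
    have h2 : ∫ x in Ω, (c • z.2 : LScalar Ω 2) x * φ x = c * ∫ x in Ω, z.2 x * φ x := by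
      rw [← integral_const_mul]
      refine integral_congr_ae ?_
      filter_upwards [Lp.coeFn_smul c z.2] with x hx
      rw [hx, Pi.smul_apply, smul_eq_mul, mul_assoc]
    have hz' := hz φ hφ
    simp only [Prod.smul_fst, Prod.smul_snd]
    rw [h1, h2, hz']; ring

/-- The vector field `v` underlying an element of `W(div; Ω)`. -/
def fieldOf {d : ℕ} {Ω : Set (Space d)} {e : Exponents} (v : Wdiv Ω e) : LVector Ω e.p :=
  v.1.1

/-- The divergence `div v ∈ L²(Ω)` of `v ∈ W(div; Ω)`. -/
def divOf {d : ℕ} {Ω : Set (Space d)} {e : Exponents} (v : Wdiv Ω e) : LScalar Ω 2 :=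
  v.1.2

/-- On an open set, an element of `W(div; Ω)` is determined by its vector field. -/
theorem Wdiv_ext {d : ℕ} {Ω : Set (Space d)} (hΩ : IsOpen Ω) {e : Exponents}
    {v w : Wdiv Ω e} (h : fieldOf v = fieldOf w) : v = w := by
  refine Subtype.ext (Prod.ext h (Lp.ext ?_))
  have hm : MemLp (fun x => v.1.2 x - w.1.2 x) 2 (volume.restrict Ω) :=
    (Lp.memLp v.1.2).sub (Lp.memLp w.1.2)
  have hloc : LocallyIntegrableOn (fun x => v.1.2 x - w.1.2 x) Ω volume :=
    locallyIntegrableOn_of_locallyIntegrable_restrict (hm.locallyIntegrable (by norm_num))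
  have hz := hΩ.ae_eq_zero_of_integral_contDiff_smul_eq_zero hloc (fun g h1 h2 h3 => by
    have hg : IsTest Ω g := ⟨h1, h2, h3⟩
    have hv := v.2 g hg
    have hw := w.2 g hg
    have hvw : v.1.1 = w.1.1 := h
    rw [hvw] at hv
    have hs : ∫ x in Ω, g x • (v.1.2 x - w.1.2 x)
        = (∫ x in Ω, v.1.2 x * g x) - ∫ x in Ω, w.1.2 x * g x := by
      rw [← integral_sub (integrable_mul_of_Lp (Lp.memLp v.1.2) (hg.memLp 2))
        (integrable_mul_of_Lp (Lp.memLp w.1.2) (hg.memLp 2))]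
      refine integral_congr_ae (.of_forall fun x => ?_)
      simp; ring
    rw [← setIntegral_eq_integral_of_forall_compl_eq_zero (s := Ω), hs]
    · linarith
    · intro x hx
      rw [image_eq_zero_of_notMem_tsupport (fun hc => hx (h3 hc)), zero_smul])
  refine (ae_restrict_iff' hΩ.measurableSet).2 ?_
  filter_upwards [hz] with x hx hxΩ
  exact sub_eq_zero.1 (hx hxΩ)

/-- The space `{ψ ∈ L²(Ω) : ∇ψ ∈ (L^{s*}(Ω))ᵈ}`, realized as the space of pairs `(ψ, ∇ψ)`. -/
def GradSpace {d : ℕ} (Ω : Set (Space d)) (e : Exponents) :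
    Submodule ℝ (LScalar Ω 2 × LVector Ω e.q) where
  carrier := {z | HasWeakGrad Ω z.1 z.2}
  zero_mem' := by
    intro φ _
    have h1 : ∫ x in Ω, φ x • (0 : LVector Ω e.q) x = 0 := by
      refine integral_eq_zero_of_ae ?_
      filter_upwards [Lp.coeFn_zero (Space d) e.q (volume.restrict Ω)] with x hx
      rw [hx]; simp
    have h2 : ∫ x in Ω, (0 : LScalar Ω 2) x • gradient φ x = 0 := by
      refine integral_eq_zero_of_ae ?_
      filter_upwards [Lp.coeFn_zero ℝ 2 (volume.restrict Ω)] with x hx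
      rw [hx]; simp
    simp only [Prod.fst_zero, Prod.snd_zero]
    rw [h1, h2, neg_zero]
  add_mem' := by
    intro y z hy hz φ hφ
    have h1 : ∫ x in Ω, (y.1 + z.1 : LScalar Ω 2) x • gradient φ x
        = (∫ x in Ω, y.1 x • gradient φ x) + ∫ x in Ω, z.1 x • gradient φ x := by
      rw [← integral_add
        (integrable_smul_of_Lp (Lp.memLp y.1) (hφ.memLp_gradient 2))
        (integrable_smul_of_Lp (Lp.memLp z.1) (hφ.memLp_gradient 2))]
      refine integral_congr_ae ?_
      filter_upwards [Lp.coeFn_add y.1 z.1] with x hx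
      rw [hx, Pi.add_apply, add_smul]
    have h2 : ∫ x in Ω, φ x • (y.2 + z.2 : LVector Ω e.q) x
        = (∫ x in Ω, φ x • y.2 x) + ∫ x in Ω, φ x • z.2 x := by
      rw [← integral_add
        (integrable_smul_of_Lp (hφ.memLp e.p) (Lp.memLp y.2))
        (integrable_smul_of_Lp (hφ.memLp e.p) (Lp.memLp z.2))]
      refine integral_congr_ae ?_
      filter_upwards [Lp.coeFn_add y.2 z.2] with x hx
      rw [hx, Pi.add_apply, smul_add]
    have hy' := hy φ hφ
    have hz' := hz φ hφ
    simp only [Prod.fst_add, Prod.snd_add]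
    rw [h1, h2, hy', hz', neg_add]
  smul_mem' := by
    intro c z hz φ hφ
    have h1 : ∫ x in Ω, (c • z.1 : LScalar Ω 2) x • gradient φ x
        = c • ∫ x in Ω, z.1 x • gradient φ x := by
      rw [← integral_smul]
      refine integral_congr_ae ?_
      filter_upwards [Lp.coeFn_smul c z.1] with x hx
      rw [hx, Pi.smul_apply, smul_eq_mul, mul_smul]
    have h2 : ∫ x in Ω, φ x • (c • z.2 : LVector Ω e.q) x = c • ∫ x in Ω, φ x • z.2 x := by
      rw [← integral_smul]
      refine integral_congr_ae ?_
      filter_upwards [Lp.coeFn_smul c z.2] with x hx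
      rw [hx, Pi.smul_apply, smul_comm]
    have hz' := hz φ hφ
    simp only [Prod.smul_fst, Prod.smul_snd]
    rw [h1, h2, hz', smul_neg]

/-- The elements of `GradSpace Ω e` with vanishing boundary values: the closure of `C_c^∞(Ω)`
for the norm `‖ψ‖_{L²} + ‖∇ψ‖_{L^{s*}}`. -/
def GradSpaceZero {d : ℕ} (Ω : Set (Space d)) (e : Exponents) :
    Submodule ℝ (GradSpace Ω e) :=
  (Submodule.span ℝ {z : LScalar Ω 2 × LVector Ω e.q | ∃ φ, IsTest Ω φ ∧
      z.1 =ᵐ[volume.restrict Ω] φ ∧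
      z.2 =ᵐ[volume.restrict Ω] gradient φ}).topologicalClosure.comap (GradSpace Ω e).subtype

/-- The space of boundary values (traces on `∂Ω`) of the functions `ψ ∈ L²(Ω)` with
`∇ψ ∈ (L^{s*}(Ω))ᵈ`: two such functions have the same boundary values when their difference is
in the closure of `C_c^∞(Ω)`. -/
abbrev TraceSpace {d : ℕ} (Ω : Set (Space d)) (e : Exponents) : Type :=
  GradSpace Ω e ⧸ GradSpaceZero Ω e

/-- For `v ∈ W(div; Ω)`, the linear form `ψ ↦ ∫_Ω ψ div v + ∫_Ω ∇ψ · v`. -/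
def greenForm {d : ℕ} {Ω : Set (Space d)} {e : Exponents} (v : Wdiv Ω e) :
    GradSpace Ω e →ₗ[ℝ] ℝ where
  toFun z := (∫ x in Ω, z.1.1 x * divOf v x) + ∫ x in Ω, inner ℝ (z.1.2 x) (fieldOf v x)
  map_add' y z := by
    have h1 : ∫ x in Ω, (y.1.1 + z.1.1 : LScalar Ω 2) x * divOf v x
        = (∫ x in Ω, y.1.1 x * divOf v x) + ∫ x in Ω, z.1.1 x * divOf v x := by
      rw [← integral_add
        (integrable_mul_of_Lp (Lp.memLp y.1.1) (Lp.memLp (divOf v)))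
        (integrable_mul_of_Lp (Lp.memLp z.1.1) (Lp.memLp (divOf v)))]
      refine integral_congr_ae ?_
      filter_upwards [Lp.coeFn_add y.1.1 z.1.1] with x hx
      rw [hx, Pi.add_apply, add_mul]
    have h2 : ∫ x in Ω, inner ℝ ((y.1.2 + z.1.2 : LVector Ω e.q) x) (fieldOf v x)
        = (∫ x in Ω, inner ℝ (y.1.2 x) (fieldOf v x))
          + ∫ x in Ω, inner ℝ (z.1.2 x) (fieldOf v x) := by
      rw [← integral_add
        (integrable_inner_of_Lp (Lp.memLp y.1.2) (Lp.memLp (fieldOf v)))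
        (integrable_inner_of_Lp (Lp.memLp z.1.2) (Lp.memLp (fieldOf v)))]
      refine integral_congr_ae ?_
      filter_upwards [Lp.coeFn_add y.1.2 z.1.2] with x hx
      rw [hx, Pi.add_apply, inner_add_left]
    simp only [Submodule.coe_add, Prod.fst_add, Prod.snd_add]
    rw [h1, h2]; ring
  map_smul' c z := by
    have h1 : ∫ x in Ω, (c • z.1.1 : LScalar Ω 2) x * divOf v x
        = c * ∫ x in Ω, z.1.1 x * divOf v x := by
      rw [← integral_const_mul]
      refine integral_congr_ae ?_
      filter_upwards [Lp.coeFn_smul c z.1.1] with x hx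
      rw [hx, Pi.smul_apply, smul_eq_mul, mul_assoc]
    have h2 : ∫ x in Ω, inner ℝ ((c • z.1.2 : LVector Ω e.q) x) (fieldOf v x)
        = c * ∫ x in Ω, inner ℝ (z.1.2 x) (fieldOf v x) := by
      rw [← integral_const_mul]
      refine integral_congr_ae ?_
      filter_upwards [Lp.coeFn_smul c z.1.2] with x hx
      rw [hx, Pi.smul_apply, real_inner_smul_left]
    simp only [Submodule.coe_smul, Prod.smul_fst, Prod.smul_snd, RingHom.id_apply, smul_eq_mul]
    rw [h1, h2]; ring

theorem gradSpaceZero_le_ker {d : ℕ} {Ω : Set (Space d)} {e : Exponents} (v : Wdiv Ω e) :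
    GradSpaceZero Ω e ≤ LinearMap.ker (greenForm v) := by
  let L : (LScalar Ω 2 × LVector Ω e.q) →L[ℝ] ℝ :=
    (((ContinuousLinearMap.mul ℝ ℝ).lpPairing (volume.restrict Ω) 2 2).flip (divOf v)).comp
        (ContinuousLinearMap.fst ℝ _ _)
      + (((innerSL ℝ (E := Space d)).lpPairing (volume.restrict Ω) e.q e.p).flip (fieldOf v)).comp
        (ContinuousLinearMap.snd ℝ _ _)
  have hL : ∀ z, L z = (∫ x in Ω, z.1 x * divOf v x) + ∫ x in Ω, inner ℝ (z.2 x) (fieldOf v x) := by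
    intro z
    simp only [L, add_apply, ContinuousLinearMap.comp_apply,
      ContinuousLinearMap.flip_apply, ContinuousLinearMap.lpPairing_eq_integral]
    rfl
  have hker : (Submodule.span ℝ {z : LScalar Ω 2 × LVector Ω e.q | ∃ φ, IsTest Ω φ ∧
      z.1 =ᵐ[volume.restrict Ω] φ ∧
      z.2 =ᵐ[volume.restrict Ω] gradient φ}).topologicalClosure
        ≤ LinearMap.ker (L : (LScalar Ω 2 × LVector Ω e.q) →ₗ[ℝ] ℝ) := by
    refine Submodule.topologicalClosure_minimal _ ?_ L.isClosed_ker
    refine Submodule.span_le.2 ?_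
    rintro z ⟨φ, hφ, h1, h2⟩
    have hv := v.2 φ hφ
    have e1 : ∫ x in Ω, z.1 x * divOf v x = ∫ x in Ω, v.1.2 x * φ x := by
      refine integral_congr_ae ?_
      filter_upwards [h1] with x hx
      rw [hx, mul_comm]; rfl
    have e2 : ∫ x in Ω, inner ℝ (z.2 x) (fieldOf v x)
        = ∫ x in Ω, inner ℝ (v.1.1 x) (gradient φ x) := by
      refine integral_congr_ae ?_
      filter_upwards [h2] with x hx
      rw [hx, real_inner_comm]; rfl
    change L z = 0
    rw [hL, e1, e2, hv]; ring
  intro z hz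
  have := hker hz
  change L z.1 = 0 at this
  rw [hL] at this
  exact this

/-- The generalized normal trace `v · ν` of `v ∈ W(div; Ω)` on `∂Ω`, as a linear form on boundary
values, given by Green's formula `⟨ψ, v · ν⟩ = ∫_Ω ψ div v + ∫_Ω ∇ψ · v`. -/
def normalTrace {d : ℕ} {Ω : Set (Space d)} {e : Exponents} (v : Wdiv Ω e) :
    TraceSpace Ω e →ₗ[ℝ] ℝ :=
  (GradSpaceZero Ω e).liftQ (greenForm v) (gradSpaceZero_le_ker v)

/-- `F(x, z) = ∑ i, a_i(x) z ^ α_i`. -/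
def F {d : ℕ} (e : Exponents) (a : Fin (e.N + 1) → Space d → ℝ) (x : Space d) (z : ℝ) : ℝ :=
  ∑ i, a i x * z ^ e.α i

/-- `(m, ρ)` solves one implicit Euler step of the mixed formulation, with time step `dt`,
porosity `φ`, coefficients `a`, source `f`, boundary datum `ρb` and previous density `ρprev`. -/
def IsMixedSolution {d : ℕ} {Ω : Set (Space d)} {e : Exponents} (dt : ℝ) (φ : Space d → ℝ)
    (a : Fin (e.N + 1) → Space d → ℝ) (f : LScalar Ω 2) (ρb : TraceSpace Ω e)
    (ρprev : LScalar Ω 2) (m : Wdiv Ω e) (ρ : LScalar Ω 2) : Prop :=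
  (∀ v : Wdiv Ω e,
    (∫ x in Ω, inner ℝ (F e a x ‖fieldOf m x‖ • fieldOf m x) (fieldOf v x))
      - (∫ x in Ω, ρ x * divOf v x) = -normalTrace v ρb) ∧
  (∀ q : LScalar Ω 2,
    (∫ x in Ω, φ x * ρ x / dt * q x) + (∫ x in Ω, divOf m x * q x)
      = (∫ x in Ω, f x * q x) + ∫ x in Ω, φ x * ρprev x / dt * q x)

end Forchheimer

end

/-
The mass balance gives `ρ` in terms of `div m`: writing `S` for the inverse of multiplication by
`φ / Δt` on `L²(Ω)`, it reads `ρ = S (f + φ ρprev / Δt - div m)`. Substituting this into the flux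
equation leaves one equation for `m`, which says that `m` is a critical point on `W(div; Ω)` of
  `m ↦ ∫_Ω ∑ i, a_i |m| ^ (α_i + 2) / (α_i + 2) + ½ ∫_Ω (Δt / φ) (div m)² - (linear form)`.
Clarkson's inequality, together with the lower bound on `a_N`, makes this functional uniformly
convex for the norm `‖m‖_{Lˢ} + ‖div m‖_{L²}`. A uniformly convex Gateaux differentiable functional
on a Banach space is bounded below and its minimizing sequences are Cauchy, so it has exactly one
critical point.
-/

noncomputable section

open Filter Topology
open scoped RealInnerProductSpace

namespace Forchheimer

section UniformConvexity

variable {E F : Type*} [NormedAddCommGroup E] [NormedSpace ℝ E] [NormedAddCommGroup F]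
  [NormedSpace ℝ F]

/-- `Φ` is uniformly convex with Gateaux derivative `A`. Uniform convexity is encoded by the gap
between `Φ` and its tangents. -/
structure UniformlyConvexWithDeriv (Φ : E → ℝ) (A : E → E →L[ℝ] ℝ) : Prop where
  hasLineDerivAt : ∀ u v, HasLineDerivAt ℝ Φ (A u v) u v
  exists_add_le : ∀ ε > 0, ∃ δ > 0, ∀ u v, ε ≤ ‖v - u‖ → Φ u + A u (v - u) + δ ≤ Φ v

theorem uniformlyConvexWithDeriv_of_isCoercive {B : E →L[ℝ] E →L[ℝ] ℝ} (hB : IsCoercive B)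
    (hsymm : ∀ u v, B u v = B v u) :
    UniformlyConvexWithDeriv (fun u => B u u / 2) (fun u => B u) where
  hasLineDerivAt u v := by
    have hid : HasDerivAt (fun t : ℝ => u + t • v) v 0 := by
      simpa using ((hasDerivAt_id (0 : ℝ)).smul_const v).const_add u
    have h := ((B.hasFDerivAt.comp_hasDerivAt 0 hid).clm_apply hid).div_const 2
    refine h.congr_deriv ?_
    simp [hsymm v u]
  exists_add_le ε hε := by
    obtain ⟨C, hC, hBC⟩ := hB
    refine ⟨C * ε ^ 2 / 2, by positivity, fun u v huv => ?_⟩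
    have hexp : B v v / 2 - (B u u / 2 + B u (v - u)) = B (v - u) (v - u) / 2 := by
      simp only [map_sub, sub_apply, hsymm v u]
      ring
    have hsq : C * ε ^ 2 ≤ C * ‖v - u‖ * ‖v - u‖ := by
      rw [mul_assoc, ← pow_two]
      gcongr
    linarith [hBC (v - u)]

namespace UniformlyConvexWithDeriv

variable {Φ : E → ℝ} {A : E → E →L[ℝ] ℝ} {Ψ : F → ℝ} {B : F → F →L[ℝ] ℝ}

theorem add_apply_le (hΦ : UniformlyConvexWithDeriv Φ A) (u v : E) :
    Φ u + A u (v - u) ≤ Φ v := by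
  rcases eq_or_ne v u with rfl | hne
  · simp
  · obtain ⟨δ, hδ, h⟩ := hΦ.exists_add_le ‖v - u‖ (norm_sub_pos_iff.2 hne)
    linarith [h u v le_rfl]

theorem prod (hΦ : UniformlyConvexWithDeriv Φ A) (hΨ : UniformlyConvexWithDeriv Ψ B) :
    UniformlyConvexWithDeriv (fun z : E × F => Φ z.1 + Ψ z.2)
      (fun z => (A z.1).coprod (B z.2)) where
  hasLineDerivAt u v := (hΦ.hasLineDerivAt u.1 v.1).add (hΨ.hasLineDerivAt u.2 v.2)
  exists_add_le ε hε := by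
    obtain ⟨δ₁, hδ₁, h₁⟩ := hΦ.exists_add_le ε hε
    obtain ⟨δ₂, hδ₂, h₂⟩ := hΨ.exists_add_le ε hε
    refine ⟨min δ₁ δ₂, lt_min hδ₁ hδ₂, fun u v huv => ?_⟩
    simp only [ContinuousLinearMap.coprod_apply, Prod.fst_sub, Prod.snd_sub]
    rw [Prod.norm_def, le_max_iff] at huv
    rcases huv with huv | huv
    · linarith [h₁ u.1 v.1 huv, hΨ.add_apply_le u.2 v.2, min_le_left δ₁ δ₂]
    · linarith [h₂ u.2 v.2 huv, hΦ.add_apply_le u.1 v.1, min_le_right δ₁ δ₂]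

theorem comp (hΦ : UniformlyConvexWithDeriv Φ A) (L : F →L[ℝ] E) {c : NNReal}
    (hL : AntilipschitzWith c L) :
    UniformlyConvexWithDeriv (fun u => Φ (L u)) (fun u => (A (L u)).comp L) where
  hasLineDerivAt u v := by
    simpa [HasLineDerivAt] using hΦ.hasLineDerivAt (L u) (L v)
  exists_add_le ε hε := by
    obtain ⟨δ, hδ, h⟩ := hΦ.exists_add_le (ε / (c + 1)) (by positivity)
    refine ⟨δ, hδ, fun u v huv => ?_⟩
    rw [ContinuousLinearMap.comp_apply, map_sub]
    refine h _ _ ((div_le_iff₀' (by positivity)).2 ?_)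
    have hdist := hL.le_mul_dist v u
    rw [dist_eq_norm, dist_eq_norm] at hdist
    linarith [norm_nonneg (L v - L u)]

theorem sub_clm (hΦ : UniformlyConvexWithDeriv Φ A) (ℓ : E →L[ℝ] ℝ) :
    UniformlyConvexWithDeriv (fun u => Φ u - ℓ u) (fun u => A u - ℓ) where
  hasLineDerivAt u v := (hΦ.hasLineDerivAt u v).sub (ℓ.hasFDerivAt.hasLineDerivAt v)
  exists_add_le ε hε := by
    obtain ⟨δ, hδ, h⟩ := hΦ.exists_add_le ε hε
    refine ⟨δ, hδ, fun u v huv => ?_⟩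
    simp only [sub_apply, map_sub]
    linarith [h u v huv, map_sub (A u) v u]

/-- The tangent gap at scale `1`, summed along a ray, grows quadratically. -/
theorem exists_sq_mul_le (hΦ : UniformlyConvexWithDeriv Φ A) :
    ∃ δ > 0, ∀ (n : ℕ) (u : E), n ≤ ‖u‖ → Φ 0 + A 0 u + n ^ 2 * δ ≤ Φ u := by
  obtain ⟨δ, hδ, hgap⟩ := hΦ.exists_add_le 1 one_pos
  refine ⟨δ, hδ, fun n u hn => ?_⟩
  rcases n.eq_zero_or_pos with rfl | hpos
  · simpa using hΦ.add_apply_le 0 u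
  set x : E := (n : ℝ)⁻¹ • u with hx
  have hx1 : 1 ≤ ‖x‖ := by
    rw [hx, norm_smul, norm_inv, RCLike.norm_natCast, ← div_eq_inv_mul]
    exact (one_le_div₀ (by positivity)).2 hn
  have hstep : ∀ k : ℕ, Φ ((k : ℝ) • x) + A ((k : ℝ) • x) x + δ ≤ Φ (((k + 1 : ℕ) : ℝ) • x) ∧
      Φ (((k + 1 : ℕ) : ℝ) • x) - A (((k + 1 : ℕ) : ℝ) • x) x + δ ≤ Φ ((k : ℝ) • x) := by
    intro k
    have hdiff : ((k + 1 : ℕ) : ℝ) • x - (k : ℝ) • x = x := by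
      rw [← sub_smul]; simp
    have h₁ := hgap ((k : ℝ) • x) (((k + 1 : ℕ) : ℝ) • x) (by rwa [hdiff])
    have h₂ := hgap (((k + 1 : ℕ) : ℝ) • x) ((k : ℝ) • x) (by rwa [norm_sub_rev, hdiff])
    rw [hdiff] at h₁
    rw [← neg_sub, hdiff, map_neg, ← sub_eq_add_neg] at h₂
    exact ⟨h₁, h₂⟩
  have hslope : ∀ k : ℕ, A 0 x + 2 * k * δ ≤ A ((k : ℝ) • x) x := by
    intro k
    induction k with
    | zero => simp
    | succ k ih =>
      push_cast at hstep ⊢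
      linarith [hstep k]
  have hray : ∀ k : ℕ, Φ 0 + k * A 0 x + k ^ 2 * δ ≤ Φ ((k : ℝ) • x) := by
    intro k
    induction k with
    | zero => simp
    | succ k ih =>
      have := (hstep k).1
      push_cast at this ⊢
      linarith [hslope k]
  have hu : (n : ℝ) • x = u := smul_inv_smul₀ (by positivity) u
  have hAu : n * A 0 x = A 0 u := by rw [← smul_eq_mul, ← map_smul, hu]
  simpa only [hu, hAu] using hray n

theorem bddBelow (hΦ : UniformlyConvexWithDeriv Φ A) : BddBelow (Set.range Φ) := by
  obtain ⟨δ, hδ, hgrow⟩ := hΦ.exists_sq_mul_le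
  refine ⟨Φ 0 - ‖A 0‖ - ‖A 0‖ ^ 2 / (4 * δ), ?_⟩
  rintro _ ⟨u, rfl⟩
  set n := ⌊‖u‖⌋₊
  have hn : ‖A 0‖ * ‖u‖ ≤ ‖A 0‖ * (n + 1) := by
    gcongr
    exact (Nat.lt_floor_add_one _).le
  have hA : -(‖A 0‖ * ‖u‖) ≤ A 0 u := (abs_le.1 ((A 0).le_opNorm u)).1
  have hsq : 0 ≤ (2 * δ * n - ‖A 0‖) ^ 2 / (4 * δ) := by positivity
  have hexp : (2 * δ * n - ‖A 0‖) ^ 2 / (4 * δ)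
      = n ^ 2 * δ - ‖A 0‖ * n + ‖A 0‖ ^ 2 / (4 * δ) := by
    field_simp
    ring
  linarith [hgrow n u (Nat.floor_le (norm_nonneg u))]

theorem exists_midpoint_add_le (hΦ : UniformlyConvexWithDeriv Φ A) {ε : ℝ} (hε : 0 < ε) :
    ∃ δ > 0, ∀ u v, ε ≤ ‖v - u‖ → Φ (midpoint ℝ u v) + δ ≤ (Φ u + Φ v) / 2 := by
  obtain ⟨δ, hδ, hgap⟩ := hΦ.exists_add_le (ε / 2) (half_pos hε)
  refine ⟨δ, hδ, fun u v huv => ?_⟩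
  have hright : v - midpoint ℝ u v = (1 / 2 : ℝ) • (v - u) := by
    rw [right_sub_midpoint]; norm_num
  have hleft : u - midpoint ℝ u v = -((1 / 2 : ℝ) • (v - u)) := by
    rw [left_sub_midpoint, ← smul_neg, neg_sub]; norm_num
  have hnorm : ε / 2 ≤ ‖(1 / 2 : ℝ) • (v - u)‖ := by
    rw [norm_smul, Real.norm_of_nonneg (by norm_num)]
    linarith
  have h₁ := hgap (midpoint ℝ u v) v (by rwa [hright])
  have h₂ := hgap (midpoint ℝ u v) u (by rwa [hleft, norm_neg])
  rw [hright] at h₁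
  rw [hleft, map_neg] at h₂
  linarith

theorem exists_forall_le [CompleteSpace E] (hΦ : UniformlyConvexWithDeriv Φ A) :
    ∃ w, ∀ v, Φ w ≤ Φ v := by
  set I := sInf (Set.range Φ)
  have hI : ∀ v, I ≤ Φ v := fun v => csInf_le hΦ.bddBelow ⟨v, rfl⟩
  obtain ⟨y, -, hlim, hmem⟩ := exists_seq_tendsto_sInf (Set.range_nonempty Φ) hΦ.bddBelow
  choose u hu using hmem
  obtain rfl : (fun n => Φ (u n)) = y := funext hu
  have hcauchy : CauchySeq u := by
    refine Metric.cauchySeq_iff.2 fun ε hε => ?_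
    obtain ⟨δ, hδ, hmid⟩ := hΦ.exists_midpoint_add_le hε
    obtain ⟨N, hN⟩ := eventually_atTop.1 (hlim.eventually_lt_const (lt_add_of_pos_right I hδ))
    refine ⟨N, fun m hm n hn => ?_⟩
    rw [dist_eq_norm]
    by_contra! hfar
    linarith [hmid (u n) (u m) hfar, hI (midpoint ℝ (u n) (u m)), hN m hm, hN n hn]
  obtain ⟨w, hw⟩ := cauchySeq_tendsto_of_complete hcauchy
  refine ⟨w, fun v => le_trans ?_ (hI v)⟩
  have htangent : Tendsto (fun n => Φ w + A w (u n - w)) atTop (𝓝 (Φ w)) := by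
    simpa using ((A w).continuous.tendsto _).comp (hw.sub_const w) |>.const_add (Φ w)
  exact le_of_tendsto_of_tendsto' htangent hlim fun n => hΦ.add_apply_le w (u n)

theorem existsUnique_deriv_eq_zero [CompleteSpace E] (hΦ : UniformlyConvexWithDeriv Φ A) :
    ∃! u, A u = 0 := by
  obtain ⟨w, hw⟩ := hΦ.exists_forall_le
  have hmin : IsLocalMin Φ w := Eventually.of_forall hw
  refine ⟨w, ContinuousLinearMap.ext fun v => hmin.hasLineDerivAt_eq_zero (hΦ.hasLineDerivAt w v),
    fun u hu => ?_⟩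
  by_contra hne
  obtain ⟨δ, hδ, hgap⟩ := hΦ.exists_add_le ‖w - u‖ (norm_sub_pos_iff.2 (Ne.symm hne))
  have := hgap u w le_rfl
  rw [hu, zero_apply] at this
  linarith [hw u]

end UniformlyConvexWithDeriv

end UniformConvexity

section MixedProblem

variable {V X Y : Type*} [NormedAddCommGroup V] [NormedSpace ℝ V] [CompleteSpace V]
  [NormedAddCommGroup X] [NormedSpace ℝ X] [NormedAddCommGroup Y] [InnerProductSpace ℝ Y]
  [CompleteSpace Y]

theorem existsUnique_mixed {Ψ : X → ℝ} {A : X → X →L[ℝ] ℝ} (hΨ : UniformlyConvexWithDeriv Ψ A)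
    {B : Y →L[ℝ] Y →L[ℝ] ℝ} (hB : IsCoercive B) (hsymm : ∀ y z, B y z = B z y)
    (P : V →L[ℝ] X) (D : V →L[ℝ] Y) {c : NNReal} (hPD : AntilipschitzWith c (P.prod D))
    (ℓ : V →L[ℝ] ℝ) (g : Y →L[ℝ] ℝ) :
    ∃! z : V × Y, (∀ v, A (P z.1) (P v) - ⟪z.2, D v⟫ = ℓ v) ∧
      ∀ q, B z.2 q + ⟪D z.1, q⟫ = g q := by
  set S : Y ≃L[ℝ] Y := hB.continuousLinearEquivOfBilin.symm
  set γ : Y := (InnerProductSpace.toDual ℝ Y).symm g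
  have hS : ∀ y z, B (S y) z = ⟪y, z⟫ := fun y z => by
    rw [← hB.continuousLinearEquivOfBilin_apply, ContinuousLinearEquiv.apply_symm_apply]
  have hbalance : ∀ m ρ, (∀ q, B ρ q + ⟪D m, q⟫ = g q) ↔ ρ = S (γ - D m) := fun m ρ => by
    rw [ContinuousLinearEquiv.eq_symm_apply, ext_iff_inner_right ℝ]
    simp only [inner_sub_left, IsCoercive.continuousLinearEquivOfBilin_apply, γ,
      InnerProductSpace.toDual_symm_apply, eq_sub_iff_add_eq]
  have hSsymm : ∀ y z, ⟪S y, z⟫ = B (S y) (S z) := fun y z => by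
    rw [hsymm, hS, real_inner_comm]
  have hreduced : ∃! m, ∀ v, A (P m) (P v) + B (S (D m)) (S (D v)) = ℓ v + ⟪S γ, D v⟫ := by
    have hcritical := (((hΨ.prod (uniformlyConvexWithDeriv_of_isCoercive hB hsymm)).comp
      (((ContinuousLinearEquiv.refl ℝ X).prodCongr S : X × Y →L[ℝ] X × Y).comp (P.prod D))
      (((ContinuousLinearEquiv.refl ℝ X).prodCongr S).antilipschitz.comp hPD)).sub_clm
        (ℓ + (innerSL ℝ (S γ)).comp D)).existsUnique_deriv_eq_zero
    simpa [sub_eq_zero, ContinuousLinearMap.ext_iff] using hcritical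
  have hflux : ∀ m, (∀ v, A (P m) (P v) - ⟪S (γ - D m), D v⟫ = ℓ v) ↔
      ∀ v, A (P m) (P v) + B (S (D m)) (S (D v)) = ℓ v + ⟪S γ, D v⟫ := fun m =>
    forall_congr' fun v => by
      rw [map_sub, inner_sub_left, ← hSsymm]
      constructor <;> intro h <;> linarith
  obtain ⟨m, hm, hunique⟩ := hreduced
  refine ⟨(m, S (γ - D m)), ⟨(hflux m).2 hm, (hbalance m _).2 rfl⟩, ?_⟩
  rintro ⟨m', ρ⟩ ⟨hmom, hbal⟩
  obtain rfl := (hbalance m' ρ).1 hbal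
  obtain rfl := hunique m' ((hflux m').1 hmom)
  rfl

end MixedProblem

section IntegralFunctional

variable {X H : Type*} [MeasurableSpace X] {μ : Measure X} [NormedAddCommGroup H]
  {p q : ℝ≥0∞}

theorem memLp_one_add_norm_rpow [IsFiniteMeasure μ] [p.HolderConjugate q] (hp : p ≠ ⊤)
    {v : X → H} (hv : MemLp v p μ) : MemLp (fun x => 1 + ‖v x‖ ^ (p.toReal - 1)) q μ := by
  have hp1 : 1 ≤ p := ENNReal.HolderConjugate.one_le p q
  have hq : p / (p - 1) = q := by
    rw [← inv_inv q, ← ENNReal.HolderConjugate.sub_one_mul_inv p q hp,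
      ENNReal.mul_inv (.inr (ENNReal.inv_ne_top.2 (zero_lt_one.trans_le hp1).ne'))
        (.inr (ENNReal.inv_ne_zero.2 hp)), inv_inv, div_eq_mul_inv, mul_comm]
  have h := hv.norm_rpow_div (p - 1)
  rw [hq, ENNReal.toReal_sub_of_le hp1 hp, ENNReal.toReal_one] at h
  exact (memLp_const (1 : ℝ)).add h

theorem Lp_norm_rpow_eq_integral [Fact (1 ≤ p)] (hp : p ≠ ⊤) (v : Lp H p μ) :
    ‖v‖ ^ p.toReal = ∫ x, ‖v x‖ ^ p.toReal ∂μ := by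
  have hp0 : p ≠ 0 := (zero_lt_one.trans_le Fact.out).ne'
  have hint : 0 ≤ ∫ x, ‖v x‖ ^ p.toReal ∂μ := by positivity
  rw [Lp.norm_def, (Lp.memLp v).eLpNorm_eq_integral_rpow_norm hp0 hp,
    ENNReal.toReal_ofReal (by positivity), ← Real.rpow_mul hint,
    inv_mul_cancel₀ (ENNReal.toReal_ne_zero.2 ⟨hp0, hp⟩), Real.rpow_one]

variable [InnerProductSpace ℝ H]

theorem integrable_inner_of_memLp [p.HolderConjugate q] {u v : X → H} (hu : MemLp u p μ)
    (hv : MemLp v q μ) : Integrable (fun x => ⟪u x, v x⟫) μ :=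
  memLp_one_iff_integrable.1 <| MemLp.of_bilin (fun a b => ⟪a, b⟫) 1 hu hv (hu.1.inner hv.1) <|
    .of_forall fun x => by simpa using nnnorm_inner_le_nnnorm (𝕜 := ℝ) (u x) (v x)

variable [CompleteSpace H]

/-- The integrands `G` with gradients `g` for which `v ↦ ∫ x, G x (v x) ∂μ` is uniformly convex on
`Lp H p μ`. -/
structure IsUniformlyConvexIntegrand (μ : Measure X) (p : ℝ≥0∞) (G : X → H → ℝ)
    (g : X → H → H) : Prop where
  aestronglyMeasurable {v : X → H} :
    AEStronglyMeasurable v μ → AEStronglyMeasurable (fun x => G x (v x)) μ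
  aestronglyMeasurable_grad {v : X → H} :
    AEStronglyMeasurable v μ → AEStronglyMeasurable (fun x => g x (v x)) μ
  apply_zero : ∀ᵐ x ∂μ, G x 0 = 0
  hasGradientAt : ∀ᵐ x ∂μ, ∀ b, HasGradientAt (G x) (g x b) b
  exists_norm_grad_le : ∃ C, ∀ᵐ x ∂μ, ∀ b, ‖g x b‖ ≤ C * (1 + ‖b‖ ^ (p.toReal - 1))
  exists_add_le : ∃ κ > 0, ∀ᵐ x ∂μ, ∀ b c,
    G x b + ⟪g x b, c - b⟫ + κ * ‖c - b‖ ^ p.toReal ≤ G x c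

namespace IsUniformlyConvexIntegrand

variable {G : X → H → ℝ} {g : X → H → H}

theorem memLp_grad [IsFiniteMeasure μ] [p.HolderConjugate q] (hp : p ≠ ⊤)
    (hG : IsUniformlyConvexIntegrand μ p G g) {v : X → H} (hv : MemLp v p μ) :
    MemLp (fun x => g x (v x)) q μ := by
  obtain ⟨C, hC⟩ := hG.exists_norm_grad_le
  exact ((memLp_one_add_norm_rpow hp hv).const_mul C).mono' (hG.aestronglyMeasurable_grad hv.1)
    (hC.mono fun x hx => hx (v x))

theorem ae_add_inner_le (hG : IsUniformlyConvexIntegrand μ p G g) :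
    ∀ᵐ x ∂μ, ∀ b c, G x b + ⟪g x b, c - b⟫ ≤ G x c := by
  obtain ⟨κ, hκ, hgap⟩ := hG.exists_add_le
  filter_upwards [hgap] with x hx b c
  linarith [hx b c, show 0 ≤ κ * ‖c - b‖ ^ p.toReal by positivity]

theorem integrable [IsFiniteMeasure μ] [p.HolderConjugate q] (hp : p ≠ ⊤)
    (hG : IsUniformlyConvexIntegrand μ p G g) {v : X → H} (hv : MemLp v p μ) :
    Integrable (fun x => G x (v x)) μ := by
  have hpair : ∀ {w : X → H}, MemLp w p μ → Integrable (fun x => ⟪v x, g x (w x)⟫) μ :=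
    fun hw => integrable_inner_of_memLp (q := q) hv (hG.memLp_grad hp hw)
  refine ((hpair (w := 0) .zero).abs.add (hpair hv).abs).mono' (hG.aestronglyMeasurable hv.1) ?_
  filter_upwards [hG.apply_zero, hG.ae_add_inner_le] with x hx0 hx
  have hlower := hx 0 (v x)
  have hupper := hx (v x) 0
  rw [hx0, zero_add, sub_zero, real_inner_comm] at hlower
  rw [hx0, zero_sub, inner_neg_right, real_inner_comm] at hupper
  simp only [Pi.add_apply, Pi.zero_apply]
  exact abs_le.2 ⟨by linarith [neg_abs_le ⟪v x, g x 0⟫, abs_nonneg ⟪v x, g x (v x)⟫],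
    by linarith [le_abs_self ⟪v x, g x (v x)⟫, abs_nonneg ⟪v x, g x 0⟫]⟩

theorem exists_integrable_bound_inner_grad [IsFiniteMeasure μ] [p.HolderConjugate q] (hp : p ≠ ⊤)
    (hG : IsUniformlyConvexIntegrand μ p G g) {u v : X → H} (hu : MemLp u p μ)
    (hv : MemLp v p μ) :
    ∃ bound : X → ℝ, Integrable bound μ ∧ ∀ᵐ x ∂μ, ∀ t ∈ Metric.ball (0 : ℝ) 1,
      ‖⟪g x (u x + t • v x), v x⟫‖ ≤ bound x := by
  obtain ⟨C, hC⟩ := hG.exists_norm_grad_le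
  have hp1 : 1 ≤ p.toReal := by
    simpa using ENNReal.toReal_mono hp (ENNReal.HolderConjugate.one_le p q)
  refine ⟨fun x => C * ((1 + ‖‖u x‖ + ‖v x‖‖ ^ (p.toReal - 1)) * ‖v x‖),
    ((memLp_one_add_norm_rpow (q := q) hp (hu.norm.add hv.norm)).integrable_mul
      hv.norm).const_mul C, ?_⟩
  filter_upwards [hC] with x hx t ht
  have hray : ‖u x + t • v x‖ ≤ ‖‖u x‖ + ‖v x‖‖ := by
    rw [Real.norm_of_nonneg (by positivity)]
    refine (norm_add_le _ _).trans (add_le_add_right ?_ _)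
    rw [norm_smul]
    exact mul_le_of_le_one_left (norm_nonneg _) (mem_ball_zero_iff.1 ht).le
  have hC0 : 0 ≤ C :=
    nonneg_of_mul_nonneg_left ((norm_nonneg _).trans (hx (u x))) (by positivity)
  calc ‖⟪g x (u x + t • v x), v x⟫‖
      ≤ ‖g x (u x + t • v x)‖ * ‖v x‖ := norm_inner_le_norm _ _
    _ ≤ C * (1 + ‖u x + t • v x‖ ^ (p.toReal - 1)) * ‖v x‖ := by gcongr; exact hx _
    _ ≤ C * (1 + ‖‖u x‖ + ‖v x‖‖ ^ (p.toReal - 1)) * ‖v x‖ := by gcongr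
    _ = _ := mul_assoc _ _ _

variable [IsFiniteMeasure μ] [Fact (1 ≤ p)] [Fact (1 ≤ q)] [p.HolderConjugate q]
  [q.HolderConjugate p]

/-- The Gateaux derivative of `v ↦ ∫ x, G x (v x) ∂μ`. -/
def deriv (hp : p ≠ ⊤) (hG : IsUniformlyConvexIntegrand μ p G g) (u : Lp H p μ) :
    Lp H p μ →L[ℝ] ℝ :=
  (innerSL ℝ).lpPairing μ q p ((hG.memLp_grad hp (Lp.memLp u)).toLp _)

theorem deriv_apply (hp : p ≠ ⊤) (hG : IsUniformlyConvexIntegrand μ p G g) (u v : Lp H p μ) :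
    hG.deriv (q := q) hp u v = ∫ x, ⟪g x (u x), v x⟫ ∂μ := by
  rw [deriv, ContinuousLinearMap.lpPairing_eq_integral]
  refine integral_congr_ae ?_
  filter_upwards [(hG.memLp_grad (q := q) hp (Lp.memLp u)).coeFn_toLp] with x hx
  rw [hx, innerSL_apply_apply]

theorem hasLineDerivAt_integral (hp : p ≠ ⊤) (hG : IsUniformlyConvexIntegrand μ p G g)
    (u v : Lp H p μ) :
    HasLineDerivAt ℝ (fun w : Lp H p μ => ∫ x, G x (w x) ∂μ) (hG.deriv (q := q) hp u v) u v := by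
  have hray : ∀ t : ℝ, MemLp (fun x => u x + t • v x) p μ := fun t =>
    (Lp.memLp u).add ((Lp.memLp v).const_smul t)
  obtain ⟨bound, hbound_int, hbound⟩ :=
    hG.exists_integrable_bound_inner_grad (q := q) hp (Lp.memLp u) (Lp.memLp v)
  have hderiv := (hasDerivAt_integral_of_dominated_loc_of_deriv_le (Metric.ball_mem_nhds 0 one_pos)
    (F := fun (t : ℝ) x => G x (u x + t • v x)) (F' := fun t x => ⟪g x (u x + t • v x), v x⟫)
    (.of_forall fun t => hG.aestronglyMeasurable (hray t).1) (hG.integrable (q := q) hp (hray 0))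
    ((hG.aestronglyMeasurable_grad (hray 0).1).inner (Lp.aestronglyMeasurable v))
    hbound hbound_int ?_).2
  · simp only [zero_smul, add_zero, ← hG.deriv_apply (q := q) hp u v] at hderiv
    refine hderiv.congr_of_eventuallyEq (.of_forall fun t => integral_congr_ae ?_)
    filter_upwards [Lp.coeFn_add u (t • v), Lp.coeFn_smul t v] with x hadd hsmul
    rw [hadd, Pi.add_apply, hsmul, Pi.smul_apply]
  · filter_upwards [hG.hasGradientAt] with x hx t _
    have hline : HasDerivAt (fun t : ℝ => u x + t • v x) (v x) t := by
      simpa using ((hasDerivAt_id t).smul_const (v x)).const_add (u x)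
    simpa [Function.comp_def] using (hx (u x + t • v x)).hasFDerivAt.comp_hasDerivAt t hline

theorem uniformlyConvexWithDeriv (hp : p ≠ ⊤) (hG : IsUniformlyConvexIntegrand μ p G g) :
    UniformlyConvexWithDeriv (fun v : Lp H p μ => ∫ x, G x (v x) ∂μ) (hG.deriv (q := q) hp) where
  hasLineDerivAt := hG.hasLineDerivAt_integral hp
  exists_add_le ε hε := by
    obtain ⟨κ, hκ, hgap⟩ := hG.exists_add_le
    refine ⟨κ * ε ^ p.toReal, by positivity, fun u v huv => ?_⟩
    have hG_int : ∀ w : Lp H p μ, Integrable (fun x => G x (w x)) μ := fun w =>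
      hG.integrable (q := q) hp (Lp.memLp w)
    have hg_int := integrable_inner_of_memLp (q := p) (hG.memLp_grad (q := q) hp (Lp.memLp u))
      (Lp.memLp (v - u))
    have hsum_int : Integrable (fun x => G x (u x) + ⟪g x (u x), (v - u) x⟫) μ :=
      (hG_int u).add hg_int
    have hnorm_int := ((Lp.memLp (v - u)).integrable_norm_rpow'.const_mul κ)
    calc (∫ x, G x (u x) ∂μ) + hG.deriv (q := q) hp u (v - u) + κ * ε ^ p.toReal
        ≤ (∫ x, G x (u x) ∂μ) + hG.deriv (q := q) hp u (v - u) + κ * ‖v - u‖ ^ p.toReal := by gcongr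
      _ = ∫ x, G x (u x) + ⟪g x (u x), (v - u) x⟫ + κ * ‖(v - u) x‖ ^ p.toReal ∂μ := by
        rw [integral_add hsum_int hnorm_int, integral_add (hG_int u) hg_int,
          integral_const_mul, Lp_norm_rpow_eq_integral hp, hG.deriv_apply]
      _ ≤ ∫ x, G x (v x) ∂μ := by
        refine integral_mono_ae (hsum_int.add hnorm_int) (hG_int v) ?_
        filter_upwards [hgap, Lp.coeFn_sub v u] with x hx hsub
        rw [hsub]
        exact hx (u x) (v x)

end IsUniformlyConvexIntegrand

end IntegralFunctional

section PowerFunctions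

variable {H : Type*} [NormedAddCommGroup H] [InnerProductSpace ℝ H] {α : ℝ}

theorem hasGradientAt_norm_rpow_div [CompleteSpace H] (hα : 0 ≤ α) (b : H) :
    HasGradientAt (fun c : H => ‖c‖ ^ (α + 2) / (α + 2)) (‖b‖ ^ α • b) b := by
  have h := (hasFDerivAt_norm_rpow b (by linarith : 1 < α + 2)).mul_const (α + 2)⁻¹
  rw [hasGradientAt_iff_hasFDerivAt]
  convert! h using 1
  ext c
  simp only [map_smul, smul_apply, InnerProductSpace.toDual_apply_apply, smul_eq_mul,
    add_sub_cancel_right, coe_innerSL_apply]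
  field_simp

theorem norm_rpow_add_inner_le (hα : 0 ≤ α) (b c : H) :
    ‖b‖ ^ (α + 2) / (α + 2) + ⟪‖b‖ ^ α • b, c - b⟫ ≤ ‖c‖ ^ (α + 2) / (α + 2) := by
  have hconj : (α + 2).HolderConjugate ((α + 2) / (α + 1)) := by
    have := Real.HolderConjugate.conjExponent (p := α + 2) (by linarith)
    rwa [Real.conjExponent, show α + 2 - 1 = α + 1 by ring] at this
  have hyoung : ‖c‖ * ‖b‖ ^ (α + 1) ≤
      ‖c‖ ^ (α + 2) / (α + 2) + ‖b‖ ^ (α + 2) * ((α + 1) / (α + 2)) := by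
    have := Real.young_inequality_of_nonneg (norm_nonneg c)
      (Real.rpow_nonneg (norm_nonneg b) (α + 1)) hconj
    rwa [← Real.rpow_mul (norm_nonneg b), mul_div_cancel₀ _ (by positivity), div_div_eq_mul_div,
      mul_div_assoc] at this
  have hcs : ‖b‖ ^ α * ⟪b, c⟫ ≤ ‖c‖ * ‖b‖ ^ (α + 1) := by
    rw [Real.rpow_add_one' (norm_nonneg b) (by positivity), mul_left_comm, mul_comm ‖c‖]
    gcongr
    exact real_inner_le_norm b c
  have hself : ‖b‖ ^ α * ⟪b, b⟫ = ‖b‖ ^ (α + 2) := by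
    rw [real_inner_self_eq_norm_sq, Real.rpow_add' (norm_nonneg b) (by positivity), Real.rpow_two]
  have hsplit : ‖b‖ ^ (α + 2) * ((α + 1) / (α + 2)) =
      ‖b‖ ^ (α + 2) - ‖b‖ ^ (α + 2) / (α + 2) := by
    field_simp
    ring
  rw [real_inner_smul_left, inner_sub_right, mul_sub, hself]
  linarith

theorem norm_midpoint_rpow_add_le {p : ℝ} (hp : 2 ≤ p) (b c : H) :
    ‖midpoint ℝ b c‖ ^ p + ‖(1 / 2 : ℝ) • (c - b)‖ ^ p ≤ (‖b‖ ^ p + ‖c‖ ^ p) / 2 := by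
  have hhalf : 1 ≤ p / 2 := by linarith
  have hsq : ∀ z : H, ‖z‖ ^ p = (‖z‖ ^ 2) ^ (p / 2) := fun z => by
    rw [← Real.rpow_natCast_mul (norm_nonneg z), Nat.cast_ofNat, mul_div_cancel₀ p two_ne_zero]
  have hparallelogram : ‖midpoint ℝ b c‖ ^ 2 + ‖(1 / 2 : ℝ) • (c - b)‖ ^ 2 =
      (1 / 2 : ℝ) • ‖b‖ ^ 2 + (1 / 2 : ℝ) • ‖c‖ ^ 2 := by
    rw [midpoint_eq_smul_add, norm_smul, norm_smul, norm_sub_rev]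
    simp only [invOf_eq_inv, norm_inv, Real.norm_ofNat, one_div, smul_eq_mul]
    linear_combination (1 / 4) * parallelogram_law_with_norm ℝ b c
  calc ‖midpoint ℝ b c‖ ^ p + ‖(1 / 2 : ℝ) • (c - b)‖ ^ p
      ≤ (‖midpoint ℝ b c‖ ^ 2 + ‖(1 / 2 : ℝ) • (c - b)‖ ^ 2) ^ (p / 2) := by
        rw [hsq, hsq ((1 / 2 : ℝ) • (c - b))]
        exact Real.add_rpow_le_rpow_add (sq_nonneg _) (sq_nonneg _) hhalf
    _ ≤ (1 / 2 : ℝ) • (‖b‖ ^ 2) ^ (p / 2) + (1 / 2 : ℝ) • (‖c‖ ^ 2) ^ (p / 2) := by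
        rw [hparallelogram]
        exact (convexOn_rpow hhalf).2 (sq_nonneg ‖b‖) (sq_nonneg ‖c‖) one_half_pos.le
          one_half_pos.le (add_halves 1)
    _ = (‖b‖ ^ p + ‖c‖ ^ p) / 2 := by
        rw [← hsq, ← hsq, smul_eq_mul, smul_eq_mul]
        ring

/-- Clarkson's inequality turns the tangent inequality at the midpoint into a quantitative one. -/
theorem norm_rpow_add_inner_add_le (hα : 0 ≤ α) (b c : H) :
    ‖b‖ ^ (α + 2) / (α + 2) + ⟪‖b‖ ^ α • b, c - b⟫ +
      (1 / 2) ^ (α + 1) / (α + 2) * ‖c - b‖ ^ (α + 2) ≤ ‖c‖ ^ (α + 2) / (α + 2) := by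
  have htangent := norm_rpow_add_inner_le hα b (midpoint ℝ b c)
  have hmid : midpoint ℝ b c - b = (1 / 2 : ℝ) • (c - b) := by
    rw [midpoint_sub_left]; norm_num
  have hclarkson := norm_midpoint_rpow_add_le (by linarith : 2 ≤ α + 2) b c
  have hhalf : ‖(1 / 2 : ℝ) • (c - b)‖ ^ (α + 2) = (1 / 2) ^ (α + 1) / 2 * ‖c - b‖ ^ (α + 2) := by
    rw [norm_smul, Real.mul_rpow (norm_nonneg _) (norm_nonneg _),
      Real.norm_of_nonneg one_half_pos.le, show α + 2 = α + 1 + 1 by ring,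
      Real.rpow_add_one one_half_pos.ne']
    ring
  rw [hmid, inner_smul_right] at htangent
  rw [hhalf] at hclarkson
  have hgap := div_le_div_of_nonneg_right hclarkson (by positivity : 0 ≤ α + 2)
  rw [add_div] at hgap
  rw [div_mul_eq_mul_div]
  linear_combination 2 * (htangent + hgap)

end PowerFunctions

namespace Exponents

variable (e : Exponents)

theorem α_nonneg (i : Fin (e.N + 1)) : 0 ≤ e.α i := by
  rw [← e.α_zero]
  exact e.strictMono.monotone (Fin.zero_le i)

theorem α_add_two_le_s (i : Fin (e.N + 1)) : e.α i + 2 ≤ e.s := by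
  unfold s
  gcongr
  exact e.strictMono.monotone (Fin.le_last i)

theorem p_toReal : e.p.toReal = e.s :=
  ENNReal.toReal_ofReal (two_pos.trans e.two_lt_s).le

theorem p_ne_top : e.p ≠ ⊤ := ENNReal.ofReal_ne_top

end Exponents

section Potential

variable {d : ℕ} {H : Type*} [NormedAddCommGroup H] {e : Exponents}
  {a : Fin (e.N + 1) → Space d → ℝ} {x : Space d}

/-- The potential `∑ i, a_i(x) ‖b‖ ^ (α_i + 2) / (α_i + 2)` of the field `b ↦ F(x, ‖b‖) b`. -/
def potential (e : Exponents) (a : Fin (e.N + 1) → Space d → ℝ) (x : Space d) (b : H) : ℝ :=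
  ∑ i, a i x * (‖b‖ ^ (e.α i + 2) / (e.α i + 2))

theorem potential_zero : potential e a x (0 : H) = 0 := by
  refine Finset.sum_eq_zero fun i _ => ?_
  rw [norm_zero, Real.zero_rpow (by linarith [e.α_nonneg i]), zero_div, mul_zero]

variable [InnerProductSpace ℝ H]

theorem F_smul_eq_sum (b : H) : F e a x ‖b‖ • b = ∑ i, a i x • ‖b‖ ^ e.α i • b := by
  simp only [F, Finset.sum_smul, smul_smul]

theorem hasGradientAt_potential [CompleteSpace H] (b : H) :
    HasGradientAt (potential e a x) (F e a x ‖b‖ • b) b := by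
  rw [hasGradientAt_iff_hasFDerivAt, F_smul_eq_sum, map_sum]
  refine HasFDerivAt.fun_sum fun i _ => ?_
  rw [map_smul]
  exact (hasGradientAt_norm_rpow_div (e.α_nonneg i) b).hasFDerivAt.const_mul (a i x)

theorem potential_add_inner_add_le (ha : ∀ i, 0 ≤ a i x) (b c : H) :
    potential e a x b + ⟪F e a x ‖b‖ • b, c - b⟫ +
      a (Fin.last e.N) x * ((1 / 2) ^ (e.s - 1) / e.s * ‖c - b‖ ^ e.s) ≤ potential e a x c := by
  let gap : Fin (e.N + 1) → ℝ := fun i =>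
    (1 / 2) ^ (e.α i + 1) / (e.α i + 2) * ‖c - b‖ ^ (e.α i + 2)
  have hgap : ∀ i, 0 ≤ a i x * gap i := fun i => by
    have := ha i
    have := e.α_nonneg i
    positivity
  have hlast : (1 / 2) ^ (e.s - 1) / e.s * ‖c - b‖ ^ e.s = gap (Fin.last e.N) := by
    rw [Exponents.s, add_sub_assoc, show (2 : ℝ) - 1 = 1 by norm_num]
  calc potential e a x b + ⟪F e a x ‖b‖ • b, c - b⟫ +
        a (Fin.last e.N) x * ((1 / 2) ^ (e.s - 1) / e.s * ‖c - b‖ ^ e.s)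
      ≤ potential e a x b + ⟪F e a x ‖b‖ • b, c - b⟫ + ∑ i, a i x * gap i := by
        rw [hlast]
        gcongr
        exact Finset.single_le_sum (fun i _ => hgap i) (Finset.mem_univ (Fin.last e.N))
    _ = ∑ i, a i x * (‖b‖ ^ (e.α i + 2) / (e.α i + 2) + ⟪‖b‖ ^ e.α i • b, c - b⟫ + gap i) := by
        rw [F_smul_eq_sum, sum_inner, potential, ← Finset.sum_add_distrib,
          ← Finset.sum_add_distrib]
        simp only [real_inner_smul_left, mul_add]
    _ ≤ potential e a x c := Finset.sum_le_sum fun i _ =>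
        mul_le_mul_of_nonneg_left (norm_rpow_add_inner_add_le (e.α_nonneg i) b c) (ha i)

theorem rpow_le_one_add_rpow {z r t : ℝ} (hz : 0 ≤ z) (hr : 0 ≤ r) (hrt : r ≤ t) :
    z ^ r ≤ 1 + z ^ t := by
  rcases le_total z 1 with hz1 | hz1
  · exact (Real.rpow_le_one hz hz1 hr).trans (le_add_of_nonneg_right (Real.rpow_nonneg hz t))
  · exact (Real.rpow_le_rpow_of_exponent_le hz1 hrt).trans (le_add_of_nonneg_left zero_le_one)

theorem norm_F_smul_le {M : ℝ} (ha : ∀ i, 0 ≤ a i x ∧ a i x ≤ M) (b : H) :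
    ‖F e a x ‖b‖ • b‖ ≤ (e.N + 1) * M * (1 + ‖b‖ ^ (e.s - 1)) := by
  have hterm : ∀ i, ‖a i x • ‖b‖ ^ e.α i • b‖ ≤ M * (1 + ‖b‖ ^ (e.s - 1)) := fun i => by
    have hα := e.α_nonneg i
    rw [norm_smul, norm_smul, Real.norm_of_nonneg (ha i).1, Real.norm_of_nonneg (by positivity),
      ← Real.rpow_add_one' (norm_nonneg b) (by linarith)]
    exact mul_le_mul (ha i).2
      (rpow_le_one_add_rpow (norm_nonneg b) (by linarith) (by linarith [e.α_add_two_le_s i]))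
      (by positivity) ((ha i).1.trans (ha i).2)
  calc ‖F e a x ‖b‖ • b‖ ≤ ∑ i, ‖a i x • ‖b‖ ^ e.α i • b‖ := by
        rw [F_smul_eq_sum]
        exact norm_sum_le _ _
    _ ≤ ∑ _i : Fin (e.N + 1), M * (1 + ‖b‖ ^ (e.s - 1)) := Finset.sum_le_sum fun i _ => hterm i
    _ = (e.N + 1) * M * (1 + ‖b‖ ^ (e.s - 1)) := by
        rw [Finset.sum_const, Finset.card_univ, Fintype.card_fin, nsmul_eq_mul, Nat.cast_add_one,
          mul_assoc]

theorem isUniformlyConvexIntegrand_potential [CompleteSpace H] {μ : Measure (Space d)}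
    {aLow aUp : ℝ} (ha_meas : ∀ i, AEMeasurable (a i) μ) (haLow : 0 < aLow)
    (ha_last : ∀ᵐ x ∂μ, aLow ≤ a (Fin.last e.N) x)
    (ha : ∀ᵐ x ∂μ, ∀ i, 0 ≤ a i x ∧ a i x ≤ aUp) :
    IsUniformlyConvexIntegrand μ e.p (potential e a) fun x (b : H) => F e a x ‖b‖ • b where
  aestronglyMeasurable hv := (Finset.aemeasurable_fun_sum _ fun i _ =>
    (ha_meas i).mul ((hv.norm.aemeasurable.pow_const _).div_const _)).aestronglyMeasurable
  aestronglyMeasurable_grad hv := (Finset.aemeasurable_fun_sum _ fun i _ =>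
    (ha_meas i).mul (hv.norm.aemeasurable.pow_const _)).aestronglyMeasurable.smul hv
  apply_zero := .of_forall fun _ => potential_zero
  hasGradientAt := .of_forall fun _ => hasGradientAt_potential
  exists_norm_grad_le := ⟨(e.N + 1) * aUp, by
    rw [e.p_toReal]
    exact ha.mono fun _ hx => norm_F_smul_le hx⟩
  exists_add_le := by
    have hs : 0 < e.s := two_pos.trans e.two_lt_s
    refine ⟨aLow * ((1 / 2) ^ (e.s - 1) / e.s), by positivity, ?_⟩
    rw [e.p_toReal]
    filter_upwards [ha, ha_last] with x hx hx_last b c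
    refine le_trans ?_ (potential_add_inner_add_le (fun i => (hx i).1) b c)
    rw [mul_assoc]
    gcongr

end Potential

section WeightedInner

variable {X H : Type*} [MeasurableSpace X] {μ : Measure X} [NormedAddCommGroup H]
  [InnerProductSpace ℝ H] {w : X → ℝ}

/-- The bilinear form `(u, v) ↦ ∫ x, w x * ⟪u x, v x⟫ ∂μ` on `Lp H 2 μ`. -/
def weightedInner (hw : MemLp w ⊤ μ) : Lp H 2 μ →L[ℝ] Lp H 2 μ →L[ℝ] ℝ :=
  (innerSL ℝ).comp ((ContinuousLinearMap.lsmul ℝ ℝ).holderL μ ⊤ 2 2 (hw.toLp w))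

theorem weightedInner_apply (hw : MemLp w ⊤ μ) (u v : Lp H 2 μ) :
    weightedInner hw u v = ∫ x, w x * ⟪u x, v x⟫ ∂μ := by
  rw [weightedInner, ContinuousLinearMap.comp_apply, innerSL_apply_apply, L2.inner_def]
  refine integral_congr_ae ?_
  filter_upwards [(ContinuousLinearMap.lsmul ℝ ℝ).coeFn_holder (r := 2) (hw.toLp w) u,
    hw.coeFn_toLp] with x hprod hweight
  rw [ContinuousLinearMap.holderL_apply_apply, hprod, hweight,
    ContinuousLinearMap.lsmul_apply, real_inner_smul_left]

theorem weightedInner_comm (hw : MemLp w ⊤ μ) (u v : Lp H 2 μ) :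
    weightedInner hw u v = weightedInner hw v u := by
  simp only [weightedInner_apply, real_inner_comm]

theorem isCoercive_weightedInner (hw : MemLp w ⊤ μ) {c : ℝ} (hc : 0 < c)
    (hcw : ∀ᵐ x ∂μ, c ≤ w x) : IsCoercive (weightedInner (H := H) hw) := by
  refine ⟨c, hc, fun u => ?_⟩
  rw [mul_assoc, ← real_inner_self_eq_norm_mul_norm, L2.inner_def, ← integral_const_mul,
    weightedInner_apply]
  have hint : Integrable (fun x => ⟪u x, u x⟫) μ := L2.integrable_inner u u
  have hweight_int : Integrable (fun x => w x * ⟪u x, u x⟫) μ :=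
    memLp_one_iff_integrable.1 ((memLp_one_iff_integrable.2 hint).mul hw)
  refine integral_mono_ae (hint.const_mul c) hweight_int (hcw.mono fun x hx => ?_)
  exact mul_le_mul_of_nonneg_right hx real_inner_self_nonneg

theorem L2_inner_eq_integral_mul (u v : Lp ℝ 2 μ) : ⟪u, v⟫ = ∫ x, u x * v x ∂μ := by
  rw [L2.inner_def]
  exact integral_congr_ae (.of_forall fun x => mul_comm (v x) (u x))

end WeightedInner

section Wdiv

variable {d : ℕ} {Ω : Set (Space d)} {e : Exponents}

/-- The linear form `(v, w) ↦ ∫_Ω h · v + ∫_Ω g w` on `(Lˢ(Ω))ᵈ × L²(Ω)`. -/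
def pairing (h : LVector Ω e.q) (g : LScalar Ω 2) : (LVector Ω e.p × LScalar Ω 2) →L[ℝ] ℝ :=
  ((innerSL ℝ).lpPairing (volume.restrict Ω) e.q e.p h).coprod (innerSL ℝ g)

theorem pairing_apply (h : LVector Ω e.q) (g : LScalar Ω 2) (z : LVector Ω e.p × LScalar Ω 2) :
    pairing h g z = (∫ x in Ω, ⟪h x, z.1 x⟫) + ∫ x in Ω, g x * z.2 x := by
  rw [pairing, ContinuousLinearMap.coprod_apply, ContinuousLinearMap.lpPairing_eq_integral,
    innerSL_apply_apply, L2_inner_eq_integral_mul]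
  rfl

theorem isClosed_Wdiv : IsClosed (Wdiv Ω e : Set (LVector Ω e.p × LScalar Ω 2)) := by
  have hWdiv : (Wdiv Ω e : Set (LVector Ω e.p × LScalar Ω 2)) =
      ⋂ (φ : Space d → ℝ) (hφ : IsTest Ω φ),
        {z | pairing ((hφ.memLp_gradient e.q).toLp _) ((hφ.memLp 2).toLp _) z = 0} := by
    ext z
    simp only [Set.mem_iInter, Set.mem_ofPred_eq, pairing_apply]
    refine forall₂_congr fun φ hφ => ?_
    have hfield : ∫ x in Ω, ⟪(hφ.memLp_gradient e.q).toLp _ x, z.1 x⟫ =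
        ∫ x in Ω, ⟪z.1 x, gradient φ x⟫ := by
      refine integral_congr_ae ?_
      filter_upwards [(hφ.memLp_gradient e.q).coeFn_toLp] with x hx
      rw [hx, real_inner_comm]
    have hdiv : ∫ x in Ω, (hφ.memLp 2).toLp _ x * z.2 x = ∫ x in Ω, z.2 x * φ x := by
      refine integral_congr_ae ?_
      filter_upwards [(hφ.memLp 2).coeFn_toLp] with x hx
      rw [hx, mul_comm]
    rw [hfield, hdiv, ← eq_neg_iff_add_eq_zero]
  rw [hWdiv]
  exact isClosed_iInter fun φ => isClosed_iInter fun hφ => (pairing _ _).isClosed_ker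

instance : CompleteSpace (Wdiv Ω e) := isClosed_Wdiv.completeSpace_coe

/-- `fieldOf` as a continuous linear map. -/
def fieldCLM (Ω : Set (Space d)) (e : Exponents) : Wdiv Ω e →L[ℝ] LVector Ω e.p :=
  (ContinuousLinearMap.fst ℝ _ _).comp (Wdiv Ω e).subtypeL

/-- `divOf` as a continuous linear map. -/
def divCLM (Ω : Set (Space d)) (e : Exponents) : Wdiv Ω e →L[ℝ] LScalar Ω 2 :=
  (ContinuousLinearMap.snd ℝ _ _).comp (Wdiv Ω e).subtypeL

theorem antilipschitzWith_fieldCLM_prod_divCLM :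
    AntilipschitzWith 1 ((fieldCLM Ω e).prod (divCLM Ω e)) :=
  (Wdiv Ω e).subtypeₗᵢ.antilipschitz

theorem exists_clm_eq_normalTrace (ρb : TraceSpace Ω e) :
    ∃ τ : Wdiv Ω e →L[ℝ] ℝ, ∀ v, τ v = normalTrace v ρb := by
  obtain ⟨ψ, rfl⟩ := (GradSpaceZero Ω e).mkQ_surjective ρb
  refine ⟨(pairing ψ.1.2 ψ.1.1).comp (Wdiv Ω e).subtypeL, fun v => ?_⟩
  rw [ContinuousLinearMap.comp_apply, pairing_apply, add_comm]
  rfl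

end Wdiv

theorem existsUnique_isMixedSolution {d : ℕ} {Ω : Set (Space d)}
    [IsFiniteMeasure (volume.restrict Ω)] {e : Exponents} {a : Fin (e.N + 1) → Space d → ℝ}
    (ha_meas : ∀ i, AEMeasurable (a i) (volume.restrict Ω)) {aLow aUp : ℝ} (haLow : 0 < aLow)
    (ha_last : ∀ᵐ x ∂volume.restrict Ω, aLow ≤ a (Fin.last e.N) x)
    (ha : ∀ᵐ x ∂volume.restrict Ω, ∀ i, 0 ≤ a i x ∧ a i x ≤ aUp)
    {φ : Space d → ℝ} (hφ_meas : AEMeasurable φ (volume.restrict Ω)) {φLow φUp : ℝ}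
    (hφLow : 0 < φLow) (hφ : ∀ᵐ x ∂volume.restrict Ω, φLow ≤ φ x ∧ φ x ≤ φUp)
    {dt : ℝ} (hdt : 0 < dt) (f : LScalar Ω 2) (ρb : TraceSpace Ω e) (ρprev : LScalar Ω 2) :
    ∃! z : Wdiv Ω e × LScalar Ω 2, IsMixedSolution dt φ a f ρb ρprev z.1 z.2 := by
  have hpotential := isUniformlyConvexIntegrand_potential (H := Space d) ha_meas haLow ha_last ha
  have hweight : MemLp (fun x => φ x / dt) ⊤ (volume.restrict Ω) := by
    refine memLp_top_of_bound (hφ_meas.div_const dt).aestronglyMeasurable (φUp / dt) ?_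
    filter_upwards [hφ] with x hx
    rw [Real.norm_of_nonneg (div_nonneg (hφLow.le.trans hx.1) hdt.le)]
    exact div_le_div_of_nonneg_right hx.2 hdt.le
  have hcoercive : IsCoercive (weightedInner (H := ℝ) hweight) :=
    isCoercive_weightedInner hweight (div_pos hφLow hdt)
      (hφ.mono fun _ hx => div_le_div_of_nonneg_right hx.1 hdt.le)
  have hweight_apply : ∀ ρ q : LScalar Ω 2,
      weightedInner hweight ρ q = ∫ x in Ω, φ x * ρ x / dt * q x := fun ρ q => by
    rw [weightedInner_apply]
    refine integral_congr_ae (.of_forall fun x => ?_)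
    simp only [RCLike.inner_apply, conj_trivial]
    ring
  obtain ⟨τ, hτ⟩ := exists_clm_eq_normalTrace ρb
  refine (existsUnique_congr fun z => ?_).1 (existsUnique_mixed
    (hpotential.uniformlyConvexWithDeriv (q := e.q) e.p_ne_top) hcoercive
    (weightedInner_comm hweight) (fieldCLM Ω e) (divCLM Ω e)
    antilipschitzWith_fieldCLM_prod_divCLM (-τ) (innerSL ℝ f + weightedInner hweight ρprev))
  refine and_congr (forall_congr' fun v => ?_) (forall_congr' fun q => ?_)
  · rw [hpotential.deriv_apply, L2_inner_eq_integral_mul, neg_apply, hτ]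
    rfl
  · rw [add_apply, innerSL_apply_apply, hweight_apply, hweight_apply, L2_inner_eq_integral_mul,
      L2_inner_eq_integral_mul]
    rfl

theorem existsUnique_timeStepping {X Y : Type*} {J : ℕ} {P : Fin J → Y → X → Y → Prop}
    (h : ∀ j y, ∃! z : X × Y, P j y z.1 z.2) (y₀ : Y) :
    ∃! z : (Fin J → X) × (Fin (J + 1) → Y),
      z.2 0 = y₀ ∧ ∀ j : Fin J, P j (z.2 j.castSucc) (z.1 j) (z.2 j.succ) := by
  choose S hS hunique using h
  let Z : Fin (J + 1) → Y := Fin.induction y₀ fun j y => (S j y).2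
  have hZ : ∀ j : Fin J, Z j.succ = (S j (Z j.castSucc)).2 := fun j => Fin.induction_succ ..
  refine ⟨(fun j => (S j (Z j.castSucc)).1, Z), ⟨rfl, fun j => ?_⟩, ?_⟩
  · simp only [hZ]
    exact hS j (Z j.castSucc)
  · rintro ⟨x, y⟩ ⟨h0, hP⟩
    have hstep : ∀ j : Fin J, (x j, y j.succ) = S j (y j.castSucc) := fun j =>
      hunique j _ (x j, y j.succ) (hP j)
    obtain rfl : y = Z := by
      funext i
      induction i using Fin.induction with
      | zero => exact h0
      | succ j ih => rw [hZ, ← ih, ← hstep]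
    exact Prod.ext (funext fun j => congrArg Prod.fst (hstep j)) rfl

end Forchheimer

end

open Forchheimer in
theorem theorem3p1_general {d : ℕ} {Ω : Set (Space d)} (hΩ : volume Ω ≠ ⊤) (e : Exponents)
    {J : ℕ} {dt : Fin J → ℝ} (hdt : ∀ j, 0 < dt j)
    {a : Fin J → Fin (e.N + 1) → Space d → ℝ}
    (ha_meas : ∀ j i, AEMeasurable (a j i) (volume.restrict Ω))
    {aLow aUp : ℝ} (haLow : 0 < aLow)
    (ha_last : ∀ j, ∀ᵐ x ∂volume.restrict Ω, aLow ≤ a j (Fin.last e.N) x)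
    (ha : ∀ j i, ∀ᵐ x ∂volume.restrict Ω, 0 ≤ a j i x ∧ a j i x ≤ aUp)
    {φ : Space d → ℝ} (hφ_meas : AEMeasurable φ (volume.restrict Ω))
    {φLow φUp : ℝ} (hφLow : 0 < φLow)
    (hφ : ∀ᵐ x ∂volume.restrict Ω, φLow ≤ φ x ∧ φ x ≤ φUp)
    (f : Fin J → LScalar Ω 2) (ρb : Fin J → TraceSpace Ω e) (ρ₀ : LScalar Ω 2) :
    (∀ (j : Fin J) (ρprev : LScalar Ω 2), ∃! z : Wdiv Ω e × LScalar Ω 2,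
      IsMixedSolution (dt j) φ (a j) (f j) (ρb j) ρprev z.1 z.2) ∧
    (∃! z : (Fin J → Wdiv Ω e) × (Fin (J + 1) → LScalar Ω 2),
      z.2 0 = ρ₀ ∧ ∀ j : Fin J,
        IsMixedSolution (dt j) φ (a j) (f j) (ρb j) (z.2 j.castSucc) (z.1 j) (z.2 j.succ)) := by
  have : IsFiniteMeasure (volume.restrict Ω) := isFiniteMeasure_restrict.2 hΩ
  have hstep : ∀ (j : Fin J) (ρprev : LScalar Ω 2), ∃! z : Wdiv Ω e × LScalar Ω 2,
      IsMixedSolution (dt j) φ (a j) (f j) (ρb j) ρprev z.1 z.2 := fun j ρprev =>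
    existsUnique_isMixedSolution (ha_meas j) haLow (ha_last j) (ae_all_iff.2 (ha j)) hφ_meas
      hφLow hφ (hdt j) (f j) (ρb j) ρprev
  exact ⟨hstep, existsUnique_timeStepping hstep ρ₀⟩

open Forchheimer in
theorem theorem3p1 {d : ℕ} (hd : 2 ≤ d) (Ω : Set (Space d)) (hΩ : IsOpen Ω)
    (hΩb : Bornology.IsBounded Ω) (e : Exponents)
    (T : ℝ) (hT : 0 < T) (J : ℕ) (hJ : 0 < J)
    (a : Fin J → Fin (e.N + 1) → Space d → ℝ)
    (ha_meas : ∀ j i, AEMeasurable (a j i) (volume.restrict Ω))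
    (aLow aUp : ℝ) (haLow : 0 < aLow)
    (ha_zero : ∀ j, ∀ᵐ x ∂volume.restrict Ω, aLow < a j 0 x ∧ a j 0 x < aUp)
    (ha_last : ∀ j, ∀ᵐ x ∂volume.restrict Ω,
      aLow < a j (Fin.last e.N) x ∧ a j (Fin.last e.N) x < aUp)
    (ha : ∀ j i, ∀ᵐ x ∂volume.restrict Ω, 0 ≤ a j i x ∧ a j i x ≤ aUp)
    (φ : Space d → ℝ) (hφ_meas : AEMeasurable φ (volume.restrict Ω))
    (φLow φUp : ℝ) (hφLow : 0 < φLow)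
    (hφ : ∀ᵐ x ∂volume.restrict Ω, φLow ≤ φ x ∧ φ x ≤ φUp)
    (f : Fin J → LScalar Ω 2) (ρb : Fin J → TraceSpace Ω e) (ρ₀ : LScalar Ω 2) :
    (∀ (j : Fin J) (ρprev : LScalar Ω 2), ∃! z : Wdiv Ω e × LScalar Ω 2,
      IsMixedSolution (T / J) φ (a j) (f j) (ρb j) ρprev z.1 z.2) ∧
    (∃! z : (Fin J → Wdiv Ω e) × (Fin (J + 1) → LScalar Ω 2),
      z.2 0 = ρ₀ ∧ ∀ j : Fin J,
        IsMixedSolution (T / J) φ (a j) (f j) (ρb j) (z.2 j.castSucc) (z.1 j) (z.2 j.succ)) := by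
  exact theorem3p1_general hΩb.measure_lt_top.ne e (fun _ => div_pos hT (Nat.cast_pos.2 hJ)) ha_meas
    haLow (fun j => (ha_last j).mono fun _ hx => hx.1.le) ha hφ_meas hφLow hφ f ρb ρ₀
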